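/- For a compact Hausdorff space $X$, let $\mathcal B(X)$ be the C*-algebra of bounded Borel functions $X\to\mathbb C$ and let $\mathcal M(X)\subseteq\mathcal B(X)$ be the ideal of those functions that vanish off a meager set, i.e. off a countable union of nowhere dense sets. The quotient $\mathcal D(X)=\mathcal B(X)/\mathcal M(X)$ is called the Dixmier algebra of $X$. Let $\mathcal N([0,1])\subseteq\mathcal B([0,1])$ be the ideal of those functions that vanish off a set of Lebesgue measure zero, and let $L^\infty([0,1])=\mathcal B([0,1])/\mathcal N([0,1])$. Theorem. There exist $*$-homomorphisms $\pi:\mathcal D([0,1])\to L^\infty([0,1])$ and $\rho:L^\infty([0,1])\to\mathcal D([0,1])$ such that $$\pi(f+\mathcal M([0,1]))=f+\mathcal N([0,1]),\qquad \rho(f+\mathcal N([0,1]))=f+\mathcal M([0,1])$$ for every continuous function $f:[0,1]\to\mathbb C$, and $\rho(\pi(a))=a$ for every $a\in\mathcal D([0,1])$. -/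

import Mathlib

open MeasureTheory Topology

namespace DixmierAlg

noncomputable section

/-! ### The quotient of a commutative *-algebra by a *-closed ideal -/

section StarQuotient

/-- An ideal that is closed under the involution. -/
class IsStarClosed {A : Type*} [CommRing A] [StarRing A] (I : Ideal A) : Prop where
  star_mem' : ∀ a ∈ I, star a ∈ I

variable {A : Type*} [CommRing A] [StarRing A] (I : Ideal A) [IsStarClosed I]

/-- The involution of `A ⧸ I` is induced by that of `A`: `star (a + I) = star a + I`. -/
instance quotientStarRing : StarRing (A ⧸ I) where
  star := Ideal.Quotient.lift I ((Ideal.Quotient.mk I).comp (starRingEnd A)) (fun a ha => by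
    rw [RingHom.comp_apply, starRingEnd_apply]
    exact Ideal.Quotient.eq_zero_iff_mem.mpr (IsStarClosed.star_mem' a ha))
  star_involutive := by
    intro q
    obtain ⟨a, rfl⟩ := Ideal.Quotient.mk_surjective q
    simp
  star_mul := by
    intro p q
    rw [map_mul, mul_comm]
  star_add := by
    intro p q
    rw [map_add]

theorem star_mk (a : A) : star (Ideal.Quotient.mk I a) = Ideal.Quotient.mk I (star a) := rfl

instance quotientStarModule {R : Type*} [CommRing R] [StarRing R] [Algebra R A] [StarModule R A] :
    StarModule R (A ⧸ I) where
  star_smul := by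
    intro r q
    obtain ⟨a, rfl⟩ := Ideal.Quotient.mk_surjective q
    change Ideal.Quotient.mk I (star (r • a)) = star r • Ideal.Quotient.mk I (star a)
    rw [star_smul]
    rfl

/-- The quotient map `a ↦ a + I`, as a *-homomorphism. -/
def quotientMk (R : Type*) [CommRing R] [Algebra R A] : A →⋆ₐ[R] A ⧸ I where
  toAlgHom := Ideal.Quotient.mkₐ R I
  map_star' := fun _ => rfl

end StarQuotient

/-! ### Bounded Borel functions, the two ideals and the two quotients -/

section BorelFunctions

/-- The bounded Borel functions `X → ℂ`, as a *-subalgebra of all functions with pointwise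
operations. -/
def boundedBorelSubalgebra (X : Type*) [TopologicalSpace X] [MeasurableSpace X] [BorelSpace X] :
    StarSubalgebra ℂ (X → ℂ) where
  carrier := {f | Measurable f ∧ ∃ C : ℝ, ∀ x, ‖f x‖ ≤ C}
  mul_mem' := by
    rintro f g ⟨hf, C, hC⟩ ⟨hg, D, hD⟩
    refine ⟨hf.mul hg, C * D, fun x => ?_⟩
    rw [Pi.mul_apply, norm_mul]
    exact mul_le_mul (hC x) (hD x) (norm_nonneg _) ((norm_nonneg _).trans (hC x))
  add_mem' := by
    rintro f g ⟨hf, C, hC⟩ ⟨hg, D, hD⟩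
    exact ⟨hf.add hg, C + D, fun x => (norm_add_le _ _).trans (add_le_add (hC x) (hD x))⟩
  algebraMap_mem' := fun r => ⟨measurable_const, ‖r‖, fun _ => le_rfl⟩
  star_mem' := by
    rintro f ⟨hf, C, hC⟩
    exact ⟨Complex.continuous_conj.measurable.comp hf, C,
      fun x => by rw [Pi.star_apply, norm_star]; exact hC x⟩

/-- The *-algebra `B(X)` of bounded Borel functions `X → ℂ`. -/
def BoundedBorel (X : Type*) [TopologicalSpace X] [MeasurableSpace X] [BorelSpace X] : Type _ :=
  ↥(boundedBorelSubalgebra X)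

variable (X : Type*) [TopologicalSpace X] [MeasurableSpace X] [BorelSpace X]

instance : CommRing (BoundedBorel X) := inferInstanceAs (CommRing ↥(boundedBorelSubalgebra X))
instance : Algebra ℂ (BoundedBorel X) := inferInstanceAs (Algebra ℂ ↥(boundedBorelSubalgebra X))
instance : StarRing (BoundedBorel X) := inferInstanceAs (StarRing ↥(boundedBorelSubalgebra X))
instance : StarModule ℂ (BoundedBorel X) :=
  inferInstanceAs (StarModule ℂ ↥(boundedBorelSubalgebra X))

instance : FunLike (BoundedBorel X) X ℂ where
  coe := Subtype.val
  coe_injective := Subtype.val_injective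

/-- The ideal `M(X)` of the bounded Borel functions that vanish off a meager set. -/
def meagerIdeal : Ideal (BoundedBorel X) where
  carrier := {f | ∃ S : Set X, IsMeagre S ∧ ∀ x, x ∉ S → f x = 0}
  zero_mem' := ⟨∅, IsMeagre.empty, fun _ _ => rfl⟩
  add_mem' := by
    rintro f g ⟨S, hS, hf⟩ ⟨T, hT, hg⟩
    refine ⟨S ∪ T, hS.union hT, fun x hx => ?_⟩
    change f x + g x = 0
    rw [hf x fun h => hx (Or.inl h), hg x fun h => hx (Or.inr h), add_zero]
  smul_mem' := by
    rintro c f ⟨S, hS, hf⟩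
    refine ⟨S, hS, fun x hx => ?_⟩
    change c x * f x = 0
    rw [hf x hx, mul_zero]

instance : IsStarClosed (meagerIdeal X) where
  star_mem' := by
    rintro f ⟨S, hS, hf⟩
    refine ⟨S, hS, fun x hx => ?_⟩
    change star (f x) = 0
    rw [hf x hx, star_zero]

/-- The Dixmier algebra `D(X) = B(X) / M(X)`. -/
def Dixmier : Type _ := BoundedBorel X ⧸ meagerIdeal X

instance : CommRing (Dixmier X) := inferInstanceAs (CommRing (BoundedBorel X ⧸ meagerIdeal X))
instance : Algebra ℂ (Dixmier X) := inferInstanceAs (Algebra ℂ (BoundedBorel X ⧸ meagerIdeal X))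
instance : StarRing (Dixmier X) := inferInstanceAs (StarRing (BoundedBorel X ⧸ meagerIdeal X))
instance : StarModule ℂ (Dixmier X) :=
  inferInstanceAs (StarModule ℂ (BoundedBorel X ⧸ meagerIdeal X))

/-- The quotient map `f ↦ f + M(X)`. -/
def Dixmier.mk : BoundedBorel X →⋆ₐ[ℂ] Dixmier X := quotientMk (meagerIdeal X) ℂ

variable {X}

/-- The ideal `N(X)` of the bounded Borel functions that vanish off a `μ`-null set. -/
def nullIdeal (μ : Measure X) : Ideal (BoundedBorel X) where
  carrier := {f | ∃ S : Set X, μ S = 0 ∧ ∀ x, x ∉ S → f x = 0}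
  zero_mem' := ⟨∅, measure_empty, fun _ _ => rfl⟩
  add_mem' := by
    rintro f g ⟨S, hS, hf⟩ ⟨T, hT, hg⟩
    refine ⟨S ∪ T, measure_union_null hS hT, fun x hx => ?_⟩
    change f x + g x = 0
    rw [hf x fun h => hx (Or.inl h), hg x fun h => hx (Or.inr h), add_zero]
  smul_mem' := by
    rintro c f ⟨S, hS, hf⟩
    refine ⟨S, hS, fun x hx => ?_⟩
    change c x * f x = 0
    rw [hf x hx, mul_zero]

instance (μ : Measure X) : IsStarClosed (nullIdeal μ) where
  star_mem' := by
    rintro f ⟨S, hS, hf⟩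
    refine ⟨S, hS, fun x hx => ?_⟩
    change star (f x) = 0
    rw [hf x hx, star_zero]

/-- `L^∞(X, μ) = B(X) / N(X)`. -/
def LInfty (μ : Measure X) : Type _ := BoundedBorel X ⧸ nullIdeal μ

section LInftyInstances

variable (μ : Measure X)

instance : CommRing (LInfty μ) := inferInstanceAs (CommRing (BoundedBorel X ⧸ nullIdeal μ))
instance : Algebra ℂ (LInfty μ) := inferInstanceAs (Algebra ℂ (BoundedBorel X ⧸ nullIdeal μ))
instance : StarRing (LInfty μ) := inferInstanceAs (StarRing (BoundedBorel X ⧸ nullIdeal μ))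
instance : StarModule ℂ (LInfty μ) :=
  inferInstanceAs (StarModule ℂ (BoundedBorel X ⧸ nullIdeal μ))

/-- The quotient map `f ↦ f + N(X)`. -/
def LInfty.mk : BoundedBorel X →⋆ₐ[ℂ] LInfty μ := quotientMk (nullIdeal μ) ℂ

end LInftyInstances

/-- A continuous function on a compact space, regarded as a bounded Borel function. -/
def ofContinuous [CompactSpace X] (f : C(X, ℂ)) : BoundedBorel X :=
  ⟨f, f.continuous.measurable, ‖f‖, f.norm_coe_le_norm⟩

end BorelFunctions

end

end DixmierAlg

open scoped ENNReal

namespace DixmierAlg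

noncomputable section

/-! ### C*-algebra structure on B(X) and its quotients -/

section CStar

variable {X : Type*} [TopologicalSpace X] [MeasurableSpace X] [BorelSpace X]

namespace BoundedBorel

theorem measurable (f : BoundedBorel X) : Measurable f := f.2.1

theorem exists_bound (f : BoundedBorel X) : ∃ C : ℝ, ∀ x, ‖f x‖ ≤ C := f.2.2

/-- The bounded Borel function with given underlying function. -/
def of (f : X → ℂ) (hf : Measurable f) (C : ℝ) (hC : ∀ x, ‖f x‖ ≤ C) : BoundedBorel X :=
  ⟨f, hf, C, hC⟩

@[simp] theorem of_apply (f : X → ℂ) (hf : Measurable f) (C : ℝ) (hC : ∀ x, ‖f x‖ ≤ C) (x : X) :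
    of f hf C hC x = f x := rfl

@[ext] theorem ext {f g : BoundedBorel X} (h : ∀ x, f x = g x) : f = g := DFunLike.ext f g h

@[simp] theorem add_apply (f g : BoundedBorel X) (x : X) : (f + g) x = f x + g x := rfl
@[simp] theorem sub_apply (f g : BoundedBorel X) (x : X) : (f - g) x = f x - g x := rfl
@[simp] theorem mul_apply (f g : BoundedBorel X) (x : X) : (f * g) x = f x * g x := rfl
@[simp] theorem one_apply (x : X) : (1 : BoundedBorel X) x = 1 := rfl
@[simp] theorem star_apply (f : BoundedBorel X) (x : X) : (star f) x = star (f x) := rfl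
@[simp] theorem smul_apply (c : ℂ) (f : BoundedBorel X) (x : X) : (c • f) x = c * f x := rfl

/-- Bounded Borel functions as bounded families of complex numbers. -/
def toLp : BoundedBorel X →+* lp (fun _ : X => ℂ) ∞ where
  toFun f := ⟨(fun x => f x : X → ℂ), memℓp_infty (by
    obtain ⟨C, hC⟩ := f.exists_bound
    exact ⟨C, by rintro _ ⟨x, rfl⟩; exact hC x⟩)⟩
  map_one' := rfl
  map_mul' _ _ := rfl
  map_zero' := rfl
  map_add' _ _ := rfl

theorem toLp_apply (f : BoundedBorel X) (x : X) : toLp f x = f x := rfl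

theorem toLp_injective : Function.Injective (toLp (X := X)) := fun f g h => by
  ext x
  rw [← toLp_apply, h, toLp_apply]

instance : NormedCommRing (BoundedBorel X) :=
  NormedCommRing.induced (BoundedBorel X) (lp (fun _ : X => ℂ) ∞) toLp toLp_injective

theorem norm_apply_le (f : BoundedBorel X) (x : X) : ‖f x‖ ≤ ‖f‖ :=
  lp.norm_apply_le_norm ENNReal.top_ne_zero (toLp f) x

theorem norm_le {f : BoundedBorel X} {C : ℝ} (hC : 0 ≤ C) (h : ∀ x, ‖f x‖ ≤ C) : ‖f‖ ≤ C :=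
  lp.norm_le_of_forall_le (f := toLp f) hC h

instance : NormedAlgebra ℂ (BoundedBorel X) where
  norm_smul_le c f := norm_le (by positivity) fun x => by
    rw [smul_apply, norm_mul]
    exact mul_le_mul_of_nonneg_left (norm_apply_le f x) (norm_nonneg c)

theorem tendsto_apply {ι : Type*} {F : Filter ι} {u : ι → BoundedBorel X} {f : BoundedBorel X}
    (h : Filter.Tendsto u F (𝓝 f)) (x : X) : Filter.Tendsto (fun i => u i x) F (𝓝 (f x)) := by
  rw [tendsto_iff_norm_sub_tendsto_zero] at h ⊢
  exact squeeze_zero (fun _ => norm_nonneg _) (fun i => norm_apply_le (u i - f) x) h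

theorem isometry_toLp : Isometry (toLp (X := X)) :=
  AddMonoidHomClass.isometry_of_norm toLp fun _ => rfl

/-- Limits in sup norm are pointwise limits, and these preserve measurability. Completeness of B(X)
follows. -/
theorem isClosed_range_toLp : IsClosed (Set.range (toLp (X := X))) := by
  refine IsSeqClosed.isClosed fun u g hu hg => ?_
  choose v hv using hu
  have hlim : ∀ x, Filter.Tendsto (fun n => v n x) Filter.atTop (𝓝 (g x)) := fun x => by
    rw [tendsto_iff_norm_sub_tendsto_zero] at hg ⊢
    refine squeeze_zero (fun _ => norm_nonneg _) (fun n => ?_) hg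
    have := lp.norm_apply_le_norm ENNReal.top_ne_zero (u n - g) x
    rw [← hv n] at this ⊢
    exact this
  exact ⟨of g (measurable_of_tendsto_metrizable (fun n => (v n).measurable)
    (tendsto_pi_nhds.2 hlim)) ‖g‖ (fun x => lp.norm_apply_le_norm ENNReal.top_ne_zero g x), rfl⟩

instance : CompleteSpace (BoundedBorel X) :=
  (completeSpace_iff_isComplete_range isometry_toLp.isUniformInducing).2
    isClosed_range_toLp.isComplete

end BoundedBorel

/-- `I` is the ideal of the functions that vanish along the countably complete filter `l`. -/
class IsVanishingIdeal (I : Ideal (BoundedBorel X)) (l : outParam (Filter X)) : Prop where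
  countableInter : CountableInterFilter l
  mem_iff : ∀ f : BoundedBorel X, f ∈ I ↔ ∀ᶠ x in l, f x = 0

variable (I : Ideal (BoundedBorel X)) {l : Filter X} [IsVanishingIdeal I l]

theorem mk_eq_mk_iff {f g : BoundedBorel X} :
    Ideal.Quotient.mk I f = Ideal.Quotient.mk I g ↔ ∀ᶠ x in l, f x = g x := by
  rw [Ideal.Quotient.eq, IsVanishingIdeal.mem_iff (I := I)]
  simp [sub_eq_zero]

theorem mk_eq_zero_iff {f : BoundedBorel X} :
    Ideal.Quotient.mk I f = 0 ↔ ∀ᶠ x in l, f x = 0 := by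
  rw [Ideal.Quotient.eq_zero_iff_mem, IsVanishingIdeal.mem_iff (I := I)]

instance isClosed_of_isVanishingIdeal : IsClosed (I : Set (BoundedBorel X)) := by
  have := IsVanishingIdeal.countableInter I
  refine IsSeqClosed.isClosed fun u f hu hf => (IsVanishingIdeal.mem_iff f).2 ?_
  have h : ∀ᶠ x in l, ∀ n, u n x = 0 :=
    eventually_countable_forall.2 fun n => (IsVanishingIdeal.mem_iff (u n)).1 (hu n)
  filter_upwards [h] with x hx
  exact tendsto_nhds_unique (BoundedBorel.tendsto_apply hf x) (by simp [hx])

/-- The truncation of `f` to the set where `‖f‖ ≤ r`. -/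
def BoundedBorel.truncate (f : BoundedBorel X) (r : ℝ) : BoundedBorel X :=
  .of ({x | ‖f x‖ ≤ r}.indicator f)
    (f.measurable.indicator (measurableSet_le f.measurable.norm measurable_const)) ‖f‖
    fun x => (norm_indicator_le_norm_self _ _).trans (f.norm_apply_le x)

theorem BoundedBorel.norm_truncate_le (f : BoundedBorel X) {r : ℝ} (hr : 0 ≤ r) :
    ‖f.truncate r‖ ≤ r := by
  refine norm_le hr fun x => ?_
  by_cases h : ‖f x‖ ≤ r
  · simp [truncate, h]
  · simp [truncate, h, hr]

/-- Truncating `f` at height `r` does not change its class, so the quotient norm is controlled by an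
essential bound. -/
theorem norm_mk_le_of_eventually {f : BoundedBorel X} {r : ℝ} (hr : 0 ≤ r)
    (h : ∀ᶠ x in l, ‖f x‖ ≤ r) : ‖Ideal.Quotient.mk I f‖ ≤ r := by
  have : Ideal.Quotient.mk I f = Ideal.Quotient.mk I (f.truncate r) := by
    rw [mk_eq_mk_iff]
    filter_upwards [h] with x hx
    simp [BoundedBorel.truncate, hx]
  rw [this]
  exact (Ideal.Quotient.norm_mk_le I _).trans (f.norm_truncate_le hr)

variable [IsStarClosed I]

/-- A near-optimal representative `g` of `star a * a` agrees with |f|² along `l`, so √‖g‖ is an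
essential bound for `f`. -/
theorem norm_mul_self_quotient_le (a : BoundedBorel X ⧸ I) : ‖a‖ * ‖a‖ ≤ ‖star a * a‖ := by
  refine le_of_forall_pos_le_add fun ε hε => ?_
  obtain ⟨f, rfl⟩ := Ideal.Quotient.mk_surjective a
  obtain ⟨g, hg, hgε⟩ :=
    Ideal.Quotient.norm_mk_lt (star (Ideal.Quotient.mk I f) * Ideal.Quotient.mk I f) hε
  rw [star_mk, ← map_mul, mk_eq_mk_iff] at hg
  have h : ‖Ideal.Quotient.mk I f‖ ≤ √‖g‖ := by
    refine norm_mk_le_of_eventually I (Real.sqrt_nonneg _) ?_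
    filter_upwards [hg] with x hx
    refine Real.le_sqrt_of_sq_le ?_
    have := g.norm_apply_le x
    rw [hx] at this
    simpa [sq] using this
  calc _ ≤ √‖g‖ * √‖g‖ := mul_self_le_mul_self (norm_nonneg _) h
    _ = ‖g‖ := Real.mul_self_sqrt (norm_nonneg _)
    _ ≤ _ := hgε.le

instance quotientCommCStarAlgebra : CommCStarAlgebra (BoundedBorel X ⧸ I) :=
  { Ideal.Quotient.normedCommRing I, Ideal.Quotient.normedAlgebra I ℂ, quotientStarRing I,
    quotientStarModule I with
    complete := CompleteSpace.complete
    norm_mul_self_le := norm_mul_self_quotient_le I }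

end CStar

/-! ### Injectivity from Gelfand duality and Gleason's theorem -/

section Injectivity

open WeakDual WeakDual.CharacterSpace

/-- If `ψ` were outside the compact image, a Urysohn function would give a nonzero element of `C`
whose image in `A` is killed by every character. -/
theorem characterSpace_comp_surjective {A C : Type*} [CommCStarAlgebra A] [CommCStarAlgebra C]
    (α : C →⋆ₐ[ℂ] A) (hα : Function.Injective α) :
    Function.Surjective (compContinuousMap α) := by
  by_contra hsurj
  rw [← Set.range_eq_univ] at hsurj
  obtain ⟨ψ, hψ⟩ := (Set.ne_univ_iff_exists_notMem _).1 hsurj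
  have hcl : IsClosed (Set.range (compContinuousMap α)) :=
    (isCompact_range (compContinuousMap α).continuous).isClosed
  obtain ⟨g, hg0, hg1, -⟩ := exists_continuous_zero_one_of_isClosed hcl
    (isClosed_singleton (x := ψ)) (Set.disjoint_singleton_right.2 hψ)
  let G : C(characterSpace ℂ C, ℂ) := ⟨fun φ => (g φ : ℂ), by fun_prop⟩
  let c : C := (gelfandStarTransform C).symm G
  have hc : ∀ φ : characterSpace ℂ C, φ c = g φ := fun φ =>
    DFunLike.congr_fun ((gelfandStarTransform C).apply_symm_apply G) φ
  have hz : α c = 0 := by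
    apply (gelfandStarTransform A).injective
    rw [map_zero]
    ext φ
    change φ (α c) = 0
    have := hc (compContinuousMap α φ)
    rw [hg0 ⟨φ, rfl⟩] at this
    simpa using this
  have hc0 : c = 0 := hα (by rw [hz, map_zero])
  have := hc ψ
  rw [hg1 rfl, hc0, map_zero] at this
  simp at this

/-- Commutative C*-algebras with extremally disconnected spectrum are injective for
*-homomorphisms of commutative C*-algebras. -/
theorem exists_extension_of_extremallyDisconnected {A B C : Type} [CommCStarAlgebra A]
    [CommCStarAlgebra B] [CommCStarAlgebra C] [ExtremallyDisconnected (characterSpace ℂ B)]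
    (α : C →⋆ₐ[ℂ] A) (hα : Function.Injective α) (β : C →⋆ₐ[ℂ] B) :
    ∃ θ : A →⋆ₐ[ℂ] B, ∀ c, θ (α c) = β c := by
  -- Projectivity lifts the map of spectra dual to `β` through the surjection dual to `α`; the dual
  -- of the lift is `θ`.
  obtain ⟨h, hcont, hh⟩ := CompactT2.ExtremallyDisconnected.projective
    (compContinuousMap β).continuous (compContinuousMap α).continuous
    (characterSpace_comp_surjective α hα)
  let H : C(characterSpace ℂ B, characterSpace ℂ A) := ⟨h, hcont⟩
  refine ⟨((gelfandStarTransform B).symm : _ →⋆ₐ[ℂ] B).comp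
    ((H.compStarAlgHom' ℂ ℂ).comp (gelfandStarTransform A : A →⋆ₐ[ℂ] _)), fun c => ?_⟩
  apply (gelfandStarTransform B).injective
  refine ((gelfandStarTransform B).apply_symm_apply _).trans ?_
  ext φ
  exact DFunLike.congr_fun (congr_fun hh φ) c

end Injectivity

/-! ### Clopen sets and extremal disconnectedness of the spectrum -/

section Spectrum

open WeakDual Filter

variable {X : Type*} [TopologicalSpace X] [MeasurableSpace X] [BorelSpace X]

/-- The characteristic function of a Borel set. -/
def BoundedBorel.ind (E : Set X) (hE : MeasurableSet E) : BoundedBorel X :=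
  .of (E.indicator 1) (measurable_one.indicator hE) 1
    fun x => (norm_indicator_le_norm_self _ _).trans (by simp)

theorem BoundedBorel.ind_apply_of_mem {E : Set X} (hE : MeasurableSet E) {x : X} (hx : x ∈ E) :
    ind E hE x = 1 := by
  simp [ind, hx]

theorem BoundedBorel.ind_apply_of_notMem {E : Set X} (hE : MeasurableSet E) {x : X} (hx : x ∉ E) :
    ind E hE x = 0 := by
  simp [ind, hx]

open BoundedBorel

variable (I : Ideal (BoundedBorel X)) {l : Filter X}

theorem exists_apply_ne_zero {A : Type*} [CommCStarAlgebra A] {a : A} (ha : a ≠ 0) :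
    ∃ φ : characterSpace ℂ A, φ a ≠ 0 := by
  by_contra! h
  refine ha ((gelfandStarTransform A).injective ?_)
  rw [map_zero]
  ext φ
  exact h φ

theorem mk_ind_mul (E F : Set X) (hE : MeasurableSet E) (hF : MeasurableSet F) :
    Ideal.Quotient.mk I (ind E hE) * Ideal.Quotient.mk I (ind F hF) =
      Ideal.Quotient.mk I (ind (E ∩ F) (hE.inter hF)) := by
  rw [← map_mul]
  congr 1
  ext x
  by_cases h1 : x ∈ E <;> by_cases h2 : x ∈ F <;> simp [ind, h1, h2]

theorem mk_ind_add_compl (E : Set X) (hE : MeasurableSet E) :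
    Ideal.Quotient.mk I (ind E hE) + Ideal.Quotient.mk I (ind Eᶜ hE.compl) = 1 := by
  rw [← map_add, ← map_one (Ideal.Quotient.mk I)]
  congr 1
  ext x
  by_cases h1 : x ∈ E <;> simp [ind, h1]

variable {I} in
theorem apply_ind_eq_zero_or_one (φ : characterSpace ℂ (BoundedBorel X ⧸ I)) (E : Set X)
    (hE : MeasurableSet E) :
    φ (Ideal.Quotient.mk I (ind E hE)) = 0 ∨ φ (Ideal.Quotient.mk I (ind E hE)) = 1 := by
  have h := congrArg φ (mk_ind_mul I E E hE hE)
  simp only [Set.inter_self, map_mul] at h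
  rw [or_iff_not_imp_left]
  exact fun h0 => mul_left_cancel₀ h0 (h.trans (mul_one _).symm)

variable {I} in
theorem apply_ind_compl (φ : characterSpace ℂ (BoundedBorel X ⧸ I)) (E : Set X)
    (hE : MeasurableSet E) :
    φ (Ideal.Quotient.mk I (ind Eᶜ hE.compl)) = 1 - φ (Ideal.Quotient.mk I (ind E hE)) := by
  rw [eq_sub_iff_add_eq', ← map_add, mk_ind_add_compl, map_one]

/-- The set of characters of `B(X) / I` that take the value `1` on the class of `E`. -/
def charSet (E : Set X) (hE : MeasurableSet E) : Set (characterSpace ℂ (BoundedBorel X ⧸ I)) :=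
  {φ | φ (Ideal.Quotient.mk I (ind E hE)) = 1}

theorem continuous_eval (a : BoundedBorel X ⧸ I) :
    Continuous fun φ : characterSpace ℂ (BoundedBorel X ⧸ I) => φ a :=
  (gelfandTransform ℂ (BoundedBorel X ⧸ I) a).continuous

theorem isClopen_charSet (E : Set X) (hE : MeasurableSet E) : IsClopen (charSet I E hE) := by
  refine ⟨isClosed_eq (continuous_eval I _) continuous_const, ?_⟩
  rw [← isClosed_compl_iff]
  convert isClosed_eq (continuous_eval I (Ideal.Quotient.mk I (ind E hE)))
    (continuous_const (y := (0 : ℂ))) using 1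
  ext φ
  rcases apply_ind_eq_zero_or_one φ E hE with h | h <;> simp [charSet, h]

theorem charSet_mono [IsVanishingIdeal I l] [IsStarClosed I] {E F : Set X} (hE : MeasurableSet E) (hF : MeasurableSet F)
    (h : ∀ᶠ x in l, x ∈ E → x ∈ F) : charSet I E hE ⊆ charSet I F hF := by
  intro φ (hφ : _ = _)
  have : Ideal.Quotient.mk I (ind E hE) * Ideal.Quotient.mk I (ind F hF) =
      Ideal.Quotient.mk I (ind E hE) := by
    rw [mk_ind_mul, mk_eq_mk_iff]
    filter_upwards [h] with x hx
    by_cases h1 : x ∈ E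
    · simp [ind, h1, hx h1]
    · simp [ind, h1]
  have := congrArg φ this
  rwa [map_mul, hφ, one_mul] at this

theorem charSet_inter (E F : Set X) (hE : MeasurableSet E) (hF : MeasurableSet F) :
    charSet I E hE ∩ charSet I F hF = charSet I (E ∩ F) (hE.inter hF) := by
  ext φ
  simp only [charSet, Set.mem_inter_iff, Set.mem_ofPred_eq, ← mk_ind_mul _ _ _ hE hF, map_mul]
  rcases apply_ind_eq_zero_or_one φ E hE with h | h <;> simp [h]

theorem charSet_eq_empty_iff [IsVanishingIdeal I l] [IsStarClosed I] {E : Set X} (hE : MeasurableSet E) :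
    charSet I E hE = ∅ ↔ ∀ᶠ x in l, x ∉ E := by
  constructor
  · intro h
    have : Ideal.Quotient.mk I (ind E hE) = 0 := by
      by_contra h0
      obtain ⟨φ, hφ⟩ := exists_apply_ne_zero h0
      exact h.subset ((apply_ind_eq_zero_or_one φ E hE).resolve_left hφ)
    rw [mk_eq_zero_iff] at this
    filter_upwards [this] with x hx hxE
    simp [ind, hxE] at hx
  · intro h
    refine Set.eq_empty_of_forall_notMem fun φ (hφ : _ = _) => ?_
    have : Ideal.Quotient.mk I (ind E hE) = 0 := by
      rw [mk_eq_zero_iff]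
      filter_upwards [h] with x hx
      simp [ind, hx]
    rw [this, map_zero] at hφ
    exact zero_ne_one hφ

/-- The sets `charSet` form a base: lift a Urysohn function for `φ` and `U` to a Borel `f` and take
E = {|f| > 1/2}. -/
theorem exists_charSet_subset [IsVanishingIdeal I l] [IsStarClosed I] 
    {U : Set (characterSpace ℂ (BoundedBorel X ⧸ I))} (hU : IsOpen U)
    {φ : characterSpace ℂ (BoundedBorel X ⧸ I)} (hφ : φ ∈ U) :
    ∃ (E : Set X) (hE : MeasurableSet E), φ ∈ charSet I E hE ∧ charSet I E hE ⊆ U := by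
  obtain ⟨g, hg0, hg1, -⟩ := exists_continuous_zero_one_of_isClosed hU.isClosed_compl
    (isClosed_singleton (x := φ)) (by simpa using hφ)
  let G : C(characterSpace ℂ (BoundedBorel X ⧸ I), ℂ) := ⟨fun φ => (g φ : ℂ), by fun_prop⟩
  obtain ⟨f, hf⟩ := Ideal.Quotient.mk_surjective ((gelfandStarTransform (BoundedBorel X ⧸ I)).symm G)
  have hfg : ∀ ψ : characterSpace ℂ (BoundedBorel X ⧸ I), ψ (Ideal.Quotient.mk I f) = g ψ :=
    fun ψ => by
      rw [hf]
      exact DFunLike.congr_fun ((gelfandStarTransform (BoundedBorel X ⧸ I)).apply_symm_apply G) ψ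
  obtain ⟨E, hE, hmem⟩ : ∃ E : Set X, MeasurableSet E ∧ ∀ x, x ∈ E ↔ 1 / 2 < ‖f x‖ :=
    ⟨_, measurableSet_lt measurable_const f.measurable.norm, fun _ => Iff.rfl⟩
  refine ⟨E, hE, ?_, fun ψ (hψ : _ = _) => ?_⟩
  · refine (apply_ind_eq_zero_or_one φ E hE).resolve_left fun h => ?_
    have hc := apply_ind_compl φ E hE
    rw [h, sub_zero] at hc
    have h1 : φ (Ideal.Quotient.mk I (f * ind Eᶜ hE.compl)) = 1 := by
      rw [map_mul, map_mul, hc, hfg, hg1 rfl]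
      simp
    have h2 : ‖φ (Ideal.Quotient.mk I (f * ind Eᶜ hE.compl))‖ ≤ 1 / 2 := by
      refine (((gelfandTransform ℂ (BoundedBorel X ⧸ I) _).norm_coe_le_norm φ).trans
        ((gelfandTransform_isometry _).norm_map_of_map_zero (map_zero _) _).le).trans ?_
      refine norm_mk_le_of_eventually I (by norm_num) (.of_forall fun x => ?_)
      by_cases hx : x ∈ E
      · simp [ind, hx]
      · simpa [ind, hx] using not_lt.1 (mt (hmem x).2 hx)
    rw [h1] at h2
    norm_num at h2
  -- On `E` the inverse of `f` is bounded by 2, so the indicator of `E` is a multiple of `f`, which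
  -- characters outside `U` kill.
  · by_contra hψU
    let h : BoundedBorel X := .of (E.indicator fun x => (f x)⁻¹) (f.measurable.inv.indicator hE) 2
      fun x => by
        by_cases hx : x ∈ E
        · have := (hmem x).1 hx
          rw [Set.indicator_of_mem hx, norm_inv, inv_le_comm₀ (by linarith) two_pos]
          linarith
        · simp [hx]
    have hfh : f * h = ind E hE := by
      ext x
      by_cases hx : x ∈ E
      · have : f x ≠ 0 := norm_pos_iff.1 (by linarith [(hmem x).1 hx])
        simp [ind, h, hx, this]
      · simp [ind, h, hx]
    rw [← hfh, map_mul, map_mul, hfg, hg0 hψU] at hψ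
    simp at hψ

/-- Every family of Borel sets has a countable subfamily whose union is an upper bound
modulo `l`. -/
def HasEssentialUnions {X : Type*} [MeasurableSpace X] (l : Filter X) : Prop :=
  ∀ 𝓔 : Set (Set X), (∀ E ∈ 𝓔, MeasurableSet E) →
    ∃ 𝓕 ⊆ 𝓔, 𝓕.Countable ∧ ∀ E ∈ 𝓔, ∀ᶠ x in l, x ∈ E → x ∈ ⋃₀ 𝓕

/-- The closure of `U` is the clopen set of the essential union of all `E` with `charSet` inside
`U`. Any excess would contain a basic set whose Borel set is essentially disjoint from each member
of the countable subfamily, hence from its union. -/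
theorem extremallyDisconnected_of_hasEssentialUnions [IsVanishingIdeal I l] [IsStarClosed I] 
    (hl : HasEssentialUnions l) :
    ExtremallyDisconnected (characterSpace ℂ (BoundedBorel X ⧸ I)) where
  open_closure U hU := by
    have := IsVanishingIdeal.countableInter I
    obtain ⟨𝓕, h𝓕, hc, h⟩ := hl {E | ∃ hE : MeasurableSet E, charSet I E hE ⊆ U} fun E hE => hE.1
    have hV : MeasurableSet (⋃₀ 𝓕) := .sUnion hc fun E hE => (h𝓕 hE).1
    suffices closure U = charSet I (⋃₀ 𝓕) hV from this ▸ (isClopen_charSet I _ _).isOpen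
    refine subset_antisymm (closure_minimal (fun φ hφ => ?_) (isClopen_charSet I _ _).isClosed) ?_
    · obtain ⟨E, hE, hφE, hEU⟩ := exists_charSet_subset I hU hφ
      exact charSet_mono I hE hV (h E ⟨hE, hEU⟩) hφE
    · intro φ hφ
      by_contra hφU
      obtain ⟨E, hE, hφE, hEU⟩ := exists_charSet_subset I
        ((isClopen_charSet I _ hV).isOpen.sdiff isClosed_closure) ⟨hφ, hφU⟩
      have hdisj : ∀ F ∈ 𝓕, ∀ᶠ x in l, x ∉ E ∩ F := fun F hF => by
        obtain ⟨hFm, hFU⟩ := h𝓕 hF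
        rw [← charSet_eq_empty_iff I (hE.inter hFm), ← charSet_inter _ _ _ hE hFm]
        exact Set.eq_empty_of_forall_notMem fun ψ hψ =>
          (hEU hψ.1).2 (subset_closure (hFU hψ.2))
      have hEV : ∀ᶠ x in l, x ∉ E ∩ ⋃₀ 𝓕 := by
        filter_upwards [(eventually_countable_ball hc).2 hdisj] with x hx hxE
        obtain ⟨F, hF, hxF⟩ := hxE.2
        exact hx F hF ⟨hxE.1, hxF⟩
      rw [← charSet_eq_empty_iff I (hE.inter hV), ← charSet_inter _ _ _ hE hV] at hEV
      exact hEV.subset ⟨hφE, hφ⟩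

/-- Exhaustion: a countable subfamily attains the supremal measure, so adjoining one more `E` adds
only a null set. -/
theorem hasEssentialUnions_ae {X : Type*} [MeasurableSpace X] (μ : Measure X) [IsFiniteMeasure μ] : HasEssentialUnions (ae μ) := by
  intro 𝓔 h𝓔
  let S : Set ENNReal := {m | ∃ 𝓕 ⊆ 𝓔, 𝓕.Countable ∧ μ (⋃₀ 𝓕) = m}
  have hS : S.Nonempty := ⟨_, ∅, Set.empty_subset _, Set.countable_empty, rfl⟩
  obtain ⟨u, -, hu, huS⟩ := exists_seq_tendsto_sSup hS (OrderTop.bddAbove S)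
  choose 𝓖 h𝓖 h𝓖c h𝓖u using huS
  have hsub : ⋃ n, 𝓖 n ⊆ 𝓔 := Set.iUnion_subset h𝓖
  have hc : (⋃ n, 𝓖 n).Countable := Set.countable_iUnion h𝓖c
  refine ⟨⋃ n, 𝓖 n, hsub, hc, fun E hE => ?_⟩
  set V := ⋃₀ ⋃ n, 𝓖 n
  have hV : MeasurableSet V := .sUnion hc fun F hF => h𝓔 F (hsub hF)
  have hmax : sSup S ≤ μ V := le_of_tendsto' hu fun n => by
    rw [← h𝓖u n]
    exact measure_mono (Set.sUnion_subset_sUnion (Set.subset_iUnion 𝓖 n))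
  have hle : μ (V ∪ E) ≤ μ V := by
    have : μ (V ∪ E) ∈ S := ⟨insert E (⋃ n, 𝓖 n), Set.insert_subset hE hsub, hc.insert E, by
      rw [Set.sUnion_insert, Set.union_comm]⟩
    exact (le_sSup this).trans hmax
  have hnull : μ (E \ V) = 0 := by
    rw [← Set.union_sdiff_left, measure_sdiff Set.subset_union_left hV.nullMeasurableSet
      (measure_ne_top μ V)]
    exact tsub_eq_zero_of_le hle
  filter_upwards [measure_eq_zero_iff_ae_notMem.1 hnull] with x hx hxE
  by_contra hxV
  exact hx ⟨hxE, hxV⟩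

/-- Replace each Borel set by an open set equal to it modulo a meagre set, then use the Lindelöf
property. -/
theorem hasEssentialUnions_residual [SecondCountableTopology X] :
    HasEssentialUnions (residual X) := by
  intro 𝓔 h𝓔
  choose! G hGo hG using fun E hE => (h𝓔 E hE).residualEq_isOpen
  obtain ⟨T, hTc, hT⟩ := TopologicalSpace.isOpen_iUnion_countable (fun E : 𝓔 => G E)
    fun E => hGo E E.2
  refine ⟨(↑) '' T, by simp, hTc.image _, fun E hE => ?_⟩
  have h : ∀ᶠ x in residual X, ∀ F ∈ T, x ∈ (F : Set X) ↔ x ∈ G F :=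
    (eventually_countable_ball hTc).2 fun F _ => (hG F F.2).mem_iff
  filter_upwards [h, (hG E hE).mem_iff] with x hx hxE hxE'
  have : x ∈ ⋃ i ∈ T, G i := hT ▸ Set.mem_iUnion.2 ⟨⟨E, hE⟩, hxE.1 hxE'⟩
  obtain ⟨F, hF, hxF⟩ := Set.mem_iUnion₂.1 this
  exact ⟨F, ⟨F, hF, rfl⟩, (hx F hF).2 hxF⟩

end Spectrum

/-! ### Rigidity of the Dixmier algebra over the continuous functions -/

section Rigidity

open WeakDual Filter BoundedBorel

variable {X : Type*} [TopologicalSpace X] [MeasurableSpace X] [BorelSpace X]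

theorem exists_eq_mk_ind_of_idempotent (I : Ideal (BoundedBorel X)) {l : Filter X}
    [IsVanishingIdeal I l] {b : BoundedBorel X ⧸ I} (hb : b * b = b) :
    ∃ (F : Set X) (hF : MeasurableSet F), b = Ideal.Quotient.mk I (ind F hF) := by
  obtain ⟨g, rfl⟩ := Ideal.Quotient.mk_surjective b
  rw [← map_mul, mk_eq_mk_iff] at hb
  obtain ⟨F, hF, hmem⟩ : ∃ F : Set X, MeasurableSet F ∧ ∀ x, x ∈ F ↔ g x = 1 :=
    ⟨_, g.measurable (measurableSet_singleton 1), fun _ => Iff.rfl⟩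
  refine ⟨F, hF, (mk_eq_mk_iff I).2 ?_⟩
  filter_upwards [hb] with x hx
  by_cases hxF : x ∈ F
  · rw [ind_apply_of_mem hF hxF, (hmem x).1 hxF]
  · rw [ind_apply_of_notMem hF hxF]
    by_contra h0
    exact hxF ((hmem x).2 (mul_left_cancel₀ h0 (hx.trans (mul_one _).symm)))

/-- Continuous functions as a *-subalgebra of `B(X)`. -/
def ofContinuousHom (X : Type*) [TopologicalSpace X] [MeasurableSpace X] [BorelSpace X]
    [CompactSpace X] : C(X, ℂ) →⋆ₐ[ℂ] BoundedBorel X where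
  toFun := ofContinuous
  map_one' := rfl
  map_mul' _ _ := rfl
  map_zero' := rfl
  map_add' _ _ := rfl
  commutes' _ := rfl
  map_star' _ := rfl

variable [CompactSpace X] (I : Ideal (BoundedBorel X)) {l : Filter X}

theorem eq_zero_of_mk_ofContinuous_eq_zero [IsVanishingIdeal I l] (hl : ∀ s ∈ l, Dense s)
    {f : C(X, ℂ)} (hf : Ideal.Quotient.mk I (ofContinuous f) = 0) : f = 0 := by
  rw [mk_eq_zero_iff] at hf
  have := Continuous.ext_on (hl _ hf) f.continuous continuous_zero fun x hx => hx
  ext x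
  exact congrFun this x

variable [T2Space X] [IsVanishingIdeal I (residual X)]

/-- A nonmeagre Borel set agrees modulo a meagre set with a nonempty open set, which supports a
Urysohn function. -/
theorem exists_continuous_mul_ind_eq_self {F : Set X} (hF : MeasurableSet F)
    (h : ¬ ∀ᶠ x in residual X, x ∉ F) :
    ∃ f : C(X, ℂ), Ideal.Quotient.mk I (ofContinuous f) ≠ 0 ∧
      Ideal.Quotient.mk I (ofContinuous f) * Ideal.Quotient.mk I (ind F hF) =
        Ideal.Quotient.mk I (ofContinuous f) := by
  obtain ⟨G, hG, hFG⟩ := hF.residualEq_isOpen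
  have hne : G.Nonempty := by
    by_contra hemp
    rw [Set.not_nonempty_iff_eq_empty] at hemp
    refine h ?_
    filter_upwards [hFG.mem_iff] with x hx hxF
    simpa [hemp] using hx.1 hxF
  obtain ⟨x₀, hx₀⟩ := hne
  obtain ⟨g, hg0, hg1, -⟩ := exists_continuous_zero_one_of_isClosed hG.isClosed_compl
    (isClosed_singleton (x := x₀)) (by simpa using hx₀)
  let f : C(X, ℂ) := ⟨fun x => (g x : ℂ), by fun_prop⟩
  refine ⟨f, fun h0 => ?_, ?_⟩
  · have hf := eq_zero_of_mk_ofContinuous_eq_zero I (fun s hs => dense_of_mem_residual hs) h0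
    have : (g x₀ : ℂ) = 0 := DFunLike.congr_fun hf x₀
    rw [hg1 rfl] at this
    simp at this
  · rw [← map_mul, mk_eq_mk_iff]
    filter_upwards [hFG.mem_iff] with x hx
    by_cases hxF : x ∈ F
    · rw [mul_apply, ind_apply_of_mem hF hxF, mul_one]
    · have : ofContinuous f x = 0 := by
        change (g x : ℂ) = 0
        rw [hg0 (fun hxG => hxF (hx.2 hxG))]
        simp
      rw [mul_apply, this, zero_mul]

variable [IsStarClosed I]

/-- Otherwise the idempotent θ(e)(1 - e) dominates some continuous c ≠ 0. Then ce = 0 and cθ(e) = c;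
applying θ to the former gives c = 0. -/
theorem map_idempotent_mul_one_sub (θ : BoundedBorel X ⧸ I →⋆ₐ[ℂ] BoundedBorel X ⧸ I)
    (hθ : ∀ f : C(X, ℂ), θ (Ideal.Quotient.mk I (ofContinuous f)) =
      Ideal.Quotient.mk I (ofContinuous f)) {e : BoundedBorel X ⧸ I} (he : e * e = e) :
    θ e * (1 - e) = 0 := by
  have hθe : θ e * θ e = θ e := by rw [← map_mul, he]
  obtain ⟨F, hF, hb⟩ := exists_eq_mk_ind_of_idempotent I (b := θ e * (1 - e))
    (by linear_combination (1 - e) ^ 2 * hθe + θ e * he)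
  by_contra h0
  rw [hb, mk_eq_zero_iff] at h0
  obtain ⟨f, hf0, hf⟩ := exists_continuous_mul_ind_eq_self I hF fun h => h0 <| by
    filter_upwards [h] with x hx using ind_apply_of_notMem hF hx
  rw [← hb] at hf
  set c := Ideal.Quotient.mk I (ofContinuous f) with hc
  have hce : c * e = 0 := by linear_combination (-e) * hf - c * θ e * he
  have hcθ : c * θ e = c := by linear_combination (1 - θ e) * hf + c * (1 - e) * hθe
  have := congrArg θ hce
  rw [map_mul, hθ, ← hc, map_zero, hcθ] at this
  exact hf0 this

/-- A *-endomorphism of the Dixmier algebra that fixes the continuous functions is the identity. -/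
theorem eq_self_of_fixes_continuous (θ : BoundedBorel X ⧸ I →⋆ₐ[ℂ] BoundedBorel X ⧸ I)
    (hθ : ∀ f : C(X, ℂ), θ (Ideal.Quotient.mk I (ofContinuous f)) =
      Ideal.Quotient.mk I (ofContinuous f)) (a : BoundedBorel X ⧸ I) : θ a = a := by
  have hidem : ∀ e : BoundedBorel X ⧸ I, e * e = e → θ e = e := fun e he => by
    have h1 := map_idempotent_mul_one_sub I θ hθ he
    have h2 := map_idempotent_mul_one_sub I θ hθ (e := 1 - e) (by linear_combination he)
    rw [map_sub, map_one] at h2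
    linear_combination h1 - h2
  -- The basic clopen sets come from idempotents, so idempotents separate characters and θ induces
  -- the identity on the spectrum.
  have hchar : ∀ φ, CharacterSpace.compContinuousMap θ φ = φ := fun φ => by
    by_contra hne
    obtain ⟨U, V, hU, hV, hφU, hφV, hUV⟩ := t2_separation hne
    obtain ⟨E, hE, hφE, hEV⟩ := exists_charSet_subset I hV hφV
    refine Set.disjoint_left.1 hUV hφU (hEV ?_)
    change φ (θ _) = 1
    rw [hidem _ (by rw [mk_ind_mul]; simp only [Set.inter_self])]
    exact hφE
  apply (gelfandStarTransform (BoundedBorel X ⧸ I)).injective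
  ext φ
  exact DFunLike.congr_fun (hchar φ) a

end Rigidity

/-! ### The two ideals and the extension maps -/

section Main

open WeakDual Filter

variable {X : Type} [TopologicalSpace X] [MeasurableSpace X] [BorelSpace X]

instance (X : Type*) [TopologicalSpace X] [MeasurableSpace X] [BorelSpace X] :
    IsVanishingIdeal (meagerIdeal X) (residual X) where
  countableInter := inferInstance
  mem_iff f := by
    constructor
    · rintro ⟨S, hS, h⟩
      filter_upwards [hS] with x hx using h x hx
    · exact fun h => ⟨{x | f x = 0}ᶜ, by rwa [IsMeagre, compl_compl], fun x hx => not_not.1 hx⟩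

instance (μ : Measure X) : IsVanishingIdeal (nullIdeal μ) (ae μ) where
  countableInter := inferInstance
  mem_iff f := by
    constructor
    · rintro ⟨S, hS, h⟩
      filter_upwards [measure_eq_zero_iff_ae_notMem.1 hS] with x hx using h x hx
    · exact fun h => ⟨{x | f x = 0}ᶜ, h, fun x hx => not_not.1 hx⟩

theorem exists_quotient_hom_of_hasEssentialUnions [CompactSpace X] [T2Space X]
    (I J : Ideal (BoundedBorel X)) {l m : Filter X} [IsVanishingIdeal I l] [IsVanishingIdeal J m]
    [IsStarClosed I] [IsStarClosed J] (hl : ∀ s ∈ l, Dense s) (hm : HasEssentialUnions m) :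
    ∃ θ : BoundedBorel X ⧸ I →⋆ₐ[ℂ] BoundedBorel X ⧸ J, ∀ f : C(X, ℂ),
      θ (Ideal.Quotient.mk I (ofContinuous f)) = Ideal.Quotient.mk J (ofContinuous f) := by
  have := extremallyDisconnected_of_hasEssentialUnions J hm
  exact exists_extension_of_extremallyDisconnected
    ((quotientMk I ℂ).comp (ofContinuousHom X))
    ((injective_iff_map_eq_zero _).2 fun f hf => eq_zero_of_mk_ofContinuous_eq_zero I hl hf)
    ((quotientMk J ℂ).comp (ofContinuousHom X))

/-- This makes conull sets dense, so that C([0,1]) embeds in L^∞. -/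
instance isOpenPosMeasure_unitInterval :
    (volume : Measure unitInterval).IsOpenPosMeasure where
  open_pos G hG hne := by
    obtain ⟨V, hV, rfl⟩ := isOpen_induced_iff.1 hG
    obtain ⟨⟨x, hx⟩, hxV⟩ := hne
    rw [Measure.Subtype.volume_def, Measure.comap_apply₀ _ _ Subtype.val_injective
      (fun s hs => (measurableSet_Icc.subtype_image hs).nullMeasurableSet)
      hG.measurableSet.nullMeasurableSet, Subtype.image_preimage_coe]
    -- Even if `x` is an endpoint, `V` meets the open interval, where Lebesgue measure on ℝ applies.
    have hcl : x ∈ closure (Set.Ioo (0 : ℝ) 1) := by rwa [closure_Ioo zero_ne_one]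
    have hpos := (hV.inter isOpen_Ioo).measure_pos volume (mem_closure_iff.1 hcl V hV hxV)
    have hsub : V ∩ Set.Ioo 0 1 ⊆ unitInterval ∩ V :=
      fun y hy => ⟨Set.Ioo_subset_Icc_self hy.2, hy.1⟩
    exact (hpos.trans_le (measure_mono hsub)).ne'

end Main
end
end DixmierAlg

theorem theorem2p22 :
    ∃ (π : DixmierAlg.Dixmier unitInterval →⋆ₐ[ℂ]
          DixmierAlg.LInfty (volume : Measure unitInterval))
      (ρ : DixmierAlg.LInfty (volume : Measure unitInterval) →⋆ₐ[ℂ]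
          DixmierAlg.Dixmier unitInterval),
      (∀ f : C(unitInterval, ℂ),
        π (DixmierAlg.Dixmier.mk unitInterval (DixmierAlg.ofContinuous f)) =
          DixmierAlg.LInfty.mk volume (DixmierAlg.ofContinuous f)) ∧
      (∀ f : C(unitInterval, ℂ),
        ρ (DixmierAlg.LInfty.mk volume (DixmierAlg.ofContinuous f)) =
          DixmierAlg.Dixmier.mk unitInterval (DixmierAlg.ofContinuous f)) ∧
      ∀ a : DixmierAlg.Dixmier unitInterval, ρ (π a) = a := by
  obtain ⟨π, hπ⟩ := DixmierAlg.exists_quotient_hom_of_hasEssentialUnions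
    (DixmierAlg.meagerIdeal unitInterval) (DixmierAlg.nullIdeal (volume : Measure unitInterval))
    (fun _ => dense_of_mem_residual) (DixmierAlg.hasEssentialUnions_ae _)
  obtain ⟨ρ, hρ⟩ := DixmierAlg.exists_quotient_hom_of_hasEssentialUnions
    (DixmierAlg.nullIdeal (volume : Measure unitInterval)) (DixmierAlg.meagerIdeal unitInterval)
    (fun _ hs => Measure.dense_of_ae hs) DixmierAlg.hasEssentialUnions_residual
  refine ⟨π, ρ, hπ, hρ, fun a => ?_⟩
  exact DixmierAlg.eq_self_of_fixes_continuous _ (ρ.comp π)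
    (fun f => (congrArg ρ (hπ f)).trans (hρ f)) a
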